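/- Let $p$ be a prime, let $\mathbb{Q}_p$ be the additive group of the field of $p$-adic numbers with its Borel $\sigma$-algebra, and let $\alpha$ be a topological automorphism of $\mathbb{Q}_p$, that is, an additive bijection continuous together with its inverse. Write $I$ for the identity map. The characteristic function of a probability distribution $\mu$ on $\mathbb{Q}_p$ is $\hat\mu(y)=\int_{\mathbb{Q}_p} y(x)\,d\mu(x)$, where $y$ runs over all continuous characters of $\mathbb{Q}_p$, i.e. continuous homomorphisms from $\mathbb{Q}_p$ to the unit circle. The conditional distribution of a random variable $L_2$ given $L_1$ is called symmetric if, for almost every value $t$ of $L_1$, the conditional distribution of $L_2$ given $L_1=t$ is invariant under $x\mapsto -x$. Let $\xi_1$ and $\xi_2$ be independent random variables with values in $\mathbb{Q}_p$ and distributions $\mu_1$ and $\mu_2$ whose characteristic functions do not vanish at any point. Assume that the conditional distribution of $L_2=\xi_1+\alpha\xi_2$ given $L_1=\xi_1+\xi_2$ is symmetric. Then the following hold. 1. If $\alpha\neq -I$, then $\mu_1$ and $\mu_2$ are degenerate distributions, i.e. each is concentrated at a single point. 2. If $\alpha=-I$, then $\mu_1=\mu_2$. Moreover, in this case the common distribution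 can be arbitrary: for every probability distribution $\omega$ on $\mathbb{Q}_p$ there exist independent random variables $\xi_1,\xi_2$ with values in $\mathbb{Q}_p$, both with distribution $\omega$, and for any such $\xi_1,\xi_2$ the conditional distribution of $\xi_1-\xi_2$ given $\xi_1+\xi_2$ is symmetric. -/

import Mathlib

open MeasureTheory ProbabilityTheory

/-- The characteristic function `μ̂(y) = ∫ (x, y) dμ(x)` of a distribution `μ` on a topological
abelian group `X`, evaluated at a character `y : X → 𝕋`. It is meant for continuous characters,
i.e. for elements of the character group of `X`. -/
noncomputable def characteristicFunction {X : Type*} [AddCommGroup X] [MeasurableSpace X]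
    (μ : Measure X) (y : AddChar X Circle) : ℂ :=
  ∫ x, (y x : ℂ) ∂μ

/-- The characteristic function of `μ` does not vanish at any element of the character group
(the group of all continuous characters) of `X`. -/
def NonvanishingCharFun {X : Type*} [AddCommGroup X] [TopologicalSpace X] [MeasurableSpace X]
    (μ : Measure X) : Prop :=
  ∀ y : AddChar X Circle, Continuous y → characteristicFunction μ y ≠ 0

/-- A distribution is degenerate if it is concentrated at one point. -/
def IsDegenerate {X : Type*} [MeasurableSpace X] (μ : Measure X) : Prop :=
  ∃ x : X, μ = Measure.dirac x

/-- The conditional distribution of `L₂` given `L₁` is symmetric: for almost every value `t` of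
`L₁`, the (regular) conditional distribution of `L₂` given `L₁ = t` is invariant under
`x ↦ -x`. -/
def CondDistribSymmetric {Ω X : Type*} [MeasurableSpace Ω] [AddCommGroup X] [MeasurableSpace X]
    [StandardBorelSpace X] (L₂ L₁ : Ω → X) (P : Measure Ω) [IsFiniteMeasure P] : Prop :=
  ∀ᵐ t ∂(P.map L₁), (condDistrib L₂ L₁ P t).map (fun x => -x) = condDistrib L₂ L₁ P t

open Filter Topology BoundedContinuousFunction

/-! ### Conditional symmetry -/

/-! Every continuous additive map of `ℚ_[p]` is multiplication by a constant, here c = α 1. Symmetry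
says that (L₁, L₂) and (L₁, -L₂) have the same law; integrating the characters χ(u L₁ + v L₂) gives
Heyde's equation f₁(u+v) f₂(u+cv) = f₁(u-v) f₂(u-cv). If c ≠ ±1, finite differences of φ₁ = log|f₁|
eliminate the other terms (`third_difference_eq_zero`), so φ₁(nd) = n² φ₁(d). Since pᵏx → 0 while
|φ₁(pᵏx)| ≥ |φ₁(x)|, continuity forces φ₁ = 0. If c = 1, two nonpositive logarithms sum to zero. So
|f₁| = 1, which means degeneracy. If c = -1, the equation yields f₁ = f₂, and characters determine
the measure. -/

theorem condDistribSymmetric_iff_map_eq {Ω X : Type*} [MeasurableSpace Ω] [AddCommGroup X]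
    [MeasurableSpace X] [StandardBorelSpace X] [MeasurableNeg X] {P : Measure Ω}
    [IsFiniteMeasure P] {L₁ L₂ : Ω → X} (hL₂ : Measurable L₂) :
    CondDistribSymmetric L₂ L₁ P ↔
      P.map (fun ω => (L₁ ω, L₂ ω)) = P.map (fun ω => (L₁ ω, -L₂ ω)) := by
  have hneg : Measurable (fun x : X => -x) := measurable_neg
  have hcomp : condDistrib ((fun x : X => -x) ∘ L₂) L₁ P =ᵐ[P.map L₁] _ :=
    condDistrib_comp L₁ hL₂.aemeasurable hneg
  have hiff := condDistrib_ae_eq_iff_measure_eq_compProd (μ := P) L₁ hL₂.aemeasurable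
    (condDistrib ((fun x : X => -x) ∘ L₂) L₁ P)
  rw [compProd_map_condDistrib (hneg.comp hL₂).aemeasurable] at hiff
  rw [CondDistribSymmetric]
  refine Iff.trans ⟨fun h => ?_, fun h => ?_⟩ hiff
  · filter_upwards [h, hcomp] with t h₁ h₂
    rw [h₂, Kernel.map_apply _ hneg, h₁]
  · filter_upwards [h, hcomp] with t h₁ h₂
    rw [h₂, Kernel.map_apply _ hneg] at h₁
    exact h₁.symm

/-! ### Characteristic functions on topological abelian groups -/

section CharacteristicFunction

variable {X : Type*} [AddCommGroup X] [TopologicalSpace X]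

/-- A continuous character as a bounded continuous complex-valued function. -/
noncomputable def boundedChar (y : AddChar X Circle) (hy : Continuous y) : X →ᵇ ℂ :=
  BoundedContinuousFunction.ofNormedAddCommGroup (fun x => (y x : ℂ))
    (continuous_subtype_val.comp hy) 1 (fun _ => (Circle.norm_coe _).le)

@[simp]
theorem boundedChar_apply (y : AddChar X Circle) (hy : Continuous y) (x : X) :
    boundedChar y hy x = y x := rfl

theorem continuous_addChar_inv {y : AddChar X Circle} (hy : Continuous y) :
    Continuous (y⁻¹ : AddChar X Circle) := by
  have : ((y⁻¹ : AddChar X Circle) : X → Circle) = fun x => (y x)⁻¹ :=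
    funext fun x => AddChar.inv_apply' y x
  rw [this]
  exact hy.inv

theorem star_boundedChar (y : AddChar X Circle) (hy : Continuous y) :
    star (boundedChar y hy) = boundedChar y⁻¹ (continuous_addChar_inv hy) := by
  ext x
  rw [BoundedContinuousFunction.star_apply, boundedChar_apply, boundedChar_apply,
    AddChar.inv_apply', Circle.coe_inv_eq_conj]
  rfl

/-- The multiplicative monoid of continuous characters. -/
def boundedCharSubmonoid (X : Type*) [AddCommGroup X] [TopologicalSpace X] :
    Submonoid (X →ᵇ ℂ) where
  carrier := {f | ∃ y hy, f = boundedChar y hy}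
  one_mem' := ⟨1, continuous_const, rfl⟩
  mul_mem' := by
    rintro _ _ ⟨y, hy, rfl⟩ ⟨z, hz, rfl⟩
    exact ⟨y * z, by simpa using hy.mul hz, by ext; simp⟩

theorem integrable_addChar [MeasurableSpace X] [OpensMeasurableSpace X] (μ : Measure X)
    [IsFiniteMeasure μ] {y : AddChar X Circle} (hy : Continuous y) :
    Integrable (fun x => (y x : ℂ)) μ :=
  BoundedContinuousFunction.integrable μ (boundedChar y hy)

/-- If the continuous characters separate points, then a finite measure is determined by its
characteristic function. -/
theorem MeasureTheory.Measure.ext_of_characteristicFunction [MeasurableSpace X] [PolishSpace X]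
    [BorelSpace X] (hsep : ∀ x : X, x ≠ 0 → ∃ y : AddChar X Circle, Continuous y ∧ y x ≠ 1)
    {μ ν : Measure X} [IsFiniteMeasure μ] [IsFiniteMeasure ν]
    (h : ∀ y : AddChar X Circle, Continuous y →
      characteristicFunction μ y = characteristicFunction ν y) : μ = ν := by
  have hstar : star (boundedCharSubmonoid X : Set (X →ᵇ ℂ)) ⊆ boundedCharSubmonoid X := by
    rintro f ⟨y, hy, hf⟩
    exact ⟨y⁻¹, continuous_addChar_inv hy, by rw [← star_boundedChar y hy, ← hf, star_star]⟩
  refine ext_of_forall_mem_subalgebra_integral_eq_of_polish (𝕜 := ℂ)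
    (A := StarAlgebra.adjoin ℂ (boundedCharSubmonoid X : Set (X →ᵇ ℂ))) ?_ ?_
  · intro x x' hxx'
    obtain ⟨y, hy, hne⟩ := hsep (x - x') (sub_ne_zero.2 hxx')
    refine ⟨boundedChar y hy, ⟨_, ⟨boundedChar y hy,
      StarAlgebra.subset_adjoin ℂ _ ⟨y, hy, rfl⟩, rfl⟩, rfl⟩, fun he => hne ?_⟩
    have he' : y x = y x' := Circle.ext he
    rw [AddChar.map_sub_eq_div, he', div_self']
  · intro g hg
    -- Characters are closed under products and conjugation, so the star algebra they generate is
    -- just their linear span.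
    rw [← StarSubalgebra.mem_toSubalgebra, StarAlgebra.adjoin_toSubalgebra,
      Set.union_eq_self_of_subset_right hstar, ← Subalgebra.mem_toSubmodule,
      Algebra.adjoin_eq_span, Submonoid.closure_eq] at hg
    induction hg using Submodule.span_induction with
    | mem f hf =>
      obtain ⟨y, hy, rfl⟩ := hf
      exact h y hy
    | zero => simp
    | add f g _ _ hf hg =>
      simp only [BoundedContinuousFunction.coe_add, Pi.add_apply]
      rw [integral_add (f.integrable μ) (g.integrable μ),
        integral_add (f.integrable ν) (g.integrable ν), hf, hg]
    | smul a f _ hf =>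
      simp only [BoundedContinuousFunction.coe_smul]
      rw [integral_smul, integral_smul, hf]

end CharacteristicFunction

section CharacteristicFunctionNorm

variable {X : Type*} [AddCommGroup X]

theorem characteristicFunction_one [MeasurableSpace X] (μ : Measure X) [IsProbabilityMeasure μ] :
    characteristicFunction μ (1 : AddChar X Circle) = 1 := by
  simp [characteristicFunction]

theorem norm_characteristicFunction_le_one [MeasurableSpace X] (μ : Measure X)
    [IsProbabilityMeasure μ] (y : AddChar X Circle) : ‖characteristicFunction μ y‖ ≤ 1 := by
  have := norm_integral_le_of_norm_le_const (μ := μ) (f := fun x => (y x : ℂ)) (C := 1)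
    (Eventually.of_forall fun _ => (Circle.norm_coe _).le)
  simpa [characteristicFunction] using this

theorem norm_characteristicFunction_inv [MeasurableSpace X] (μ : Measure X)
    (y : AddChar X Circle) : ‖characteristicFunction μ y⁻¹‖ = ‖characteristicFunction μ y‖ := by
  have : characteristicFunction μ y⁻¹ = (starRingEnd ℂ) (characteristicFunction μ y) := by
    rw [characteristicFunction, characteristicFunction, ← integral_conj]
    simp_rw [AddChar.inv_apply', Circle.coe_inv_eq_conj]
  rw [this, RCLike.norm_conj]

/-- A character whose characteristic function has modulus one is almost surely constant. -/
theorem exists_ae_eq_of_norm_characteristicFunction_eq_one [MeasurableSpace X] {μ : Measure X}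
    [IsProbabilityMeasure μ] {y : AddChar X Circle} (h : ‖characteristicFunction μ y‖ = 1) :
    ∃ c : ℂ, ∀ᵐ x ∂μ, (y x : ℂ) = c := by
  rcases ae_eq_const_or_norm_integral_lt_of_norm_le_const (μ := μ) (f := fun x => (y x : ℂ))
    (C := 1) (Eventually.of_forall fun _ => (Circle.norm_coe _).le) with h' | h'
  · exact ⟨_, h'⟩
  · simp only [characteristicFunction] at h
    simp [h] at h'

end CharacteristicFunctionNorm

/-! ### Heyde's functional equation -/

section FunctionalEquation

variable {K : Type*} [Field K] [CharZero K] {φ₁ φ₂ : K → ℝ} {c : K}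

/-- Moving (u, v) along (c, 1), (-c, 1) or (1, 1) fixes u - cv, u + cv or u - v respectively. Scaled
by a, b, l, each move shifts u + v by d. In the alternating sum over the resulting cube, every term
but φ₁(u + v) cancels. -/
theorem third_difference_eq_zero (hc : c ≠ -1) (hc' : c ≠ 1)
    (h : ∀ u v, φ₁ (u + v) + φ₂ (u + c * v) = φ₁ (u - v) + φ₂ (u - c * v)) (x d : K) :
    φ₁ (x + 3 * d) - 3 * φ₁ (x + 2 * d) + 3 * φ₁ (x + d) - φ₁ x = 0 := by
  have h₁ : (1 + c) ≠ 0 := fun h0 => hc (by linear_combination h0)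
  have h₂ : (1 - c) ≠ 0 := fun h0 => hc' (by linear_combination -h0)
  obtain ⟨a, ha⟩ : ∃ a, (1 + c) * a = d := ⟨d / (1 + c), by field_simp⟩
  obtain ⟨b, hb⟩ : ∃ b, (1 - c) * b = d := ⟨d / (1 - c), by field_simp⟩
  obtain ⟨l, hl⟩ : ∃ l, 2 * l = d := ⟨d / 2, by field_simp⟩
  have key : ∀ u v s t₁ t₂ t₃ : K, u + v = s → u - v = t₁ → u - c * v = t₂ → u + c * v = t₃ →
      φ₁ s = φ₁ t₁ + φ₂ t₂ - φ₂ t₃ := by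
    rintro u v _ _ _ _ rfl rfl rfl rfl
    linarith [h u v]
  have e000 := key x 0 x x x x (by ring) (by ring) (by ring) (by ring)
  have e100 := key (x + c * a) a (x + d) (x + (c - 1) * a) x (x + 2 * c * a)
    (by linear_combination ha) (by ring) (by ring) (by ring)
  have e010 := key (x - c * b) b (x + d) (x - (c + 1) * b) (x - 2 * c * b) x
    (by linear_combination hb) (by ring) (by ring) (by ring)
  have e001 := key (x + l) l (x + d) x (x + (1 - c) * l) (x + (1 + c) * l)
    (by linear_combination hl) (by ring) (by ring) (by ring)
  have e110 := key (x + c * a - c * b) (a + b) (x + 2 * d) (x + (c - 1) * a - (c + 1) * b)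
    (x - 2 * c * b) (x + 2 * c * a)
    (by linear_combination ha + hb) (by ring) (by ring) (by ring)
  have e101 := key (x + c * a + l) (a + l) (x + 2 * d) (x + (c - 1) * a) (x + (1 - c) * l)
    (x + 2 * c * a + (1 + c) * l)
    (by linear_combination ha + hl) (by ring) (by ring) (by ring)
  have e011 := key (x - c * b + l) (b + l) (x + 2 * d) (x - (c + 1) * b)
    (x - 2 * c * b + (1 - c) * l) (x + (1 + c) * l)
    (by linear_combination hb + hl) (by ring) (by ring) (by ring)
  have e111 := key (x + c * a - c * b + l) (a + b + l) (x + 3 * d)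
    (x + (c - 1) * a - (c + 1) * b) (x - 2 * c * b + (1 - c) * l) (x + 2 * c * a + (1 + c) * l)
    (by linear_combination ha + hb + hl) (by ring) (by ring) (by ring)
  linarith

theorem map_natCast_mul_eq_sq_mul {φ : K → ℝ} (h0 : φ 0 = 0) (heven : ∀ x, φ (-x) = φ x)
    (h3 : ∀ x d, φ (x + 3 * d) - 3 * φ (x + 2 * d) + 3 * φ (x + d) - φ x = 0) (n : ℕ) (d : K) :
    φ (n * d) = (n : ℝ) ^ 2 * φ d := by
  have h2 : φ (2 * d) = 4 * φ d := by
    -- The progression -d, 0, d, 2d lets evenness supply the third initial value of the recurrence.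
    have := h3 (-d) d
    rw [show -d + 3 * d = 2 * d by ring, show -d + 2 * d = d by ring, neg_add_cancel, heven,
      h0] at this
    linarith
  have : φ (n * d) = (n : ℝ) ^ 2 * φ d ∧ φ ((n + 1) * d) = ((n : ℝ) + 1) ^ 2 * φ d ∧
      φ ((n + 2) * d) = ((n : ℝ) + 2) ^ 2 * φ d := by
    induction n with
    | zero => refine ⟨by simp [h0], by simp, ?_⟩; norm_num [h2]
    | succ n ih =>
      obtain ⟨i₀, i₁, i₂⟩ := ih
      push_cast
      refine ⟨i₁, ?_, ?_⟩
      · rw [show (n : K) + 1 + 1 = n + 2 by ring, i₂]; ring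
      · have := h3 (n * d) d
        rw [show (n : K) * d + 3 * d = (n + 1 + 2) * d by ring,
          show (n : K) * d + 2 * d = (n + 2) * d by ring,
          show (n : K) * d + d = (n + 1) * d by ring, i₀, i₁, i₂] at this
        linear_combination this
  exact this.1

theorem eq_zero_of_third_difference_eq_zero {p : ℕ} [Fact p.Prime] {φ : ℚ_[p] → ℝ}
    (hφ : Continuous φ) (h0 : φ 0 = 0) (heven : ∀ x, φ (-x) = φ x)
    (h3 : ∀ x d, φ (x + 3 * d) - 3 * φ (x + 2 * d) + 3 * φ (x + d) - φ x = 0) (x : ℚ_[p]) :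
    φ x = 0 := by
  have hp : Tendsto (fun k : ℕ => ((p : ℚ_[p]) ^ k) * x) atTop (𝓝 0) := by
    have := (tendsto_pow_atTop_nhds_zero_of_norm_lt_one
      (Padic.norm_p_lt_one (p := p))).mul_const x
    simpa using this
  have hlim : Tendsto (fun k : ℕ => |φ ((p : ℚ_[p]) ^ k * x)|) atTop (𝓝 0) := by
    have := ((hφ.tendsto 0).comp hp).abs
    simpa [h0, Function.comp_def] using this
  have hle : ∀ k : ℕ, |φ x| ≤ |φ ((p : ℚ_[p]) ^ k * x)| := fun k => by
    have := map_natCast_mul_eq_sq_mul h0 heven h3 (p ^ k) x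
    push_cast at this
    rw [this, abs_mul]
    refine le_mul_of_one_le_left (abs_nonneg _) ?_
    have h1 : (1 : ℝ) ≤ p := by exact_mod_cast (Fact.out : p.Prime).one_lt.le
    rw [abs_of_nonneg (by positivity)]
    exact one_le_pow₀ (one_le_pow₀ h1)
  exact abs_nonpos_iff.1 (ge_of_tendsto' hlim hle)

theorem eq_zero_of_heyde_equation {p : ℕ} [Fact p.Prime] {φ₁ φ₂ : ℚ_[p] → ℝ} {c : ℚ_[p]}
    (hc : c ≠ -1) (hφ₁ : Continuous φ₁) (h0₁ : φ₁ 0 = 0) (h0₂ : φ₂ 0 = 0)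
    (heven : ∀ x, φ₁ (-x) = φ₁ x) (hle₁ : ∀ x, φ₁ x ≤ 0) (hle₂ : ∀ x, φ₂ x ≤ 0)
    (h : ∀ u v, φ₁ (u + v) + φ₂ (u + c * v) = φ₁ (u - v) + φ₂ (u - c * v)) (x : ℚ_[p]) :
    φ₁ x = 0 := by
  by_cases hc' : c = 1
  -- Both arguments on the right become 0, leaving φ₁ x + φ₂ x = 0.
  · have := h (x / 2) (x / 2)
    rw [hc', one_mul, add_halves, sub_self, h0₁, h0₂] at this
    linarith [hle₁ x, hle₂ x]
  · exact eq_zero_of_third_difference_eq_zero hφ₁ h0₁ heven (third_difference_eq_zero hc hc' h) x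

end FunctionalEquation

/-! ### Characters and automorphisms of `ℚ_[p]` -/

section Padic

variable {p : ℕ} [Fact p.Prime]

/-- The map q ↦ exp(2πiq) has kernel ℤ. It turns ℚ/ℤ-valued characters into circle-valued ones. -/
theorem exists_addChar_rat_quotient :
    ∃ e : AddCircle (1 : ℚ) →+ Additive Circle, Function.Injective e := by
  let g : ℚ →+ Additive Circle :=
    { toFun := fun q => Additive.ofMul (Circle.exp (2 * Real.pi * q))
      map_zero' := by simp
      map_add' := fun a b => by
        rw [← ofMul_mul, ← Circle.exp_add]; push_cast; rw [mul_add] }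
  have hker : AddSubgroup.zmultiples (1 : ℚ) = g.ker := by
    ext q
    rw [AddMonoidHom.mem_ker, AddSubgroup.mem_zmultiples_iff]
    change _ ↔ Additive.ofMul (Circle.exp (2 * Real.pi * q)) = 0
    rw [ofMul_eq_zero, Circle.exp_eq_one]
    refine exists_congr fun n => ?_
    have hpi : (2 * Real.pi) ≠ 0 := by positivity
    rw [mul_comm (n : ℝ), mul_right_inj' hpi, eq_comm, zsmul_one]
    norm_cast
  exact ⟨QuotientAddGroup.lift _ g hker.le, by
    rw [← AddMonoidHom.ker_eq_bot_iff, QuotientAddGroup.ker_lift, ← hker,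
      QuotientAddGroup.map_mk'_self]⟩

/-- There is a nontrivial continuous character of `ℚ_[p]`. -/
theorem Padic.exists_continuous_addChar_ne_one :
    ∃ χ : AddChar ℚ_[p] Circle, Continuous χ ∧ ∃ x, χ x ≠ 1 := by
  let Z : AddSubgroup ℚ_[p] := (PadicInt.subring p).toAddSubgroup
  have hp : (p : ℚ_[p])⁻¹ ∉ Z := by
    change ¬ ‖(p : ℚ_[p])⁻¹‖ ≤ 1
    rw [norm_inv, Padic.norm_p, inv_inv, not_le]
    exact_mod_cast (Fact.out : p.Prime).one_lt
  obtain ⟨e, he⟩ := exists_addChar_rat_quotient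
  -- Some ℚ/ℤ-valued character of ℚ_p/ℤ_p detects the class of 1/p. Its pullback is trivial on the
  -- open subgroup ℤ_p, hence locally constant.
  obtain ⟨c, hc⟩ := CharacterModule.exists_character_apply_ne_zero_of_ne_zero
    (a := (((p : ℚ_[p])⁻¹ : ℚ_[p]) : ℚ_[p] ⧸ Z)) (by rwa [Ne, QuotientAddGroup.eq_zero_iff])
  let c' : (ℚ_[p] ⧸ Z) →+ AddCircle (1 : ℚ) := c
  let f : ℚ_[p] →+ Additive Circle := (e.comp c').comp (QuotientAddGroup.mk' Z)
  let χ : AddChar ℚ_[p] Circle := AddChar.toAddMonoidHomEquiv.symm f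
  have hχ : ∀ x, χ x = (f x).toMul := fun _ => rfl
  have hball : ∀ x : ℚ_[p], ‖x‖ ≤ 1 → χ x = 1 := fun x hx => by
    have : ((x : ℚ_[p]) : ℚ_[p] ⧸ Z) = 0 := (QuotientAddGroup.eq_zero_iff x).2 hx
    rw [hχ]
    change (e (c' (x : ℚ_[p] ⧸ Z))).toMul = 1
    rw [this, map_zero, map_zero, toMul_zero]
  refine ⟨χ, ?_, (p : ℚ_[p])⁻¹, fun h => hc ?_⟩
  · refine IsLocallyConstant.continuous ((IsLocallyConstant.iff_eventually_eq _).2 fun x => ?_)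
    filter_upwards [Metric.ball_mem_nhds x one_pos] with z hz
    have : χ (z - x) = 1 := hball _ (by rw [← dist_eq_norm]; exact (Metric.mem_ball.1 hz).le)
    rwa [AddChar.map_sub_eq_div, div_eq_one] at this
  · have h' : e (c' (((p : ℚ_[p])⁻¹ : ℚ_[p]) : ℚ_[p] ⧸ Z)) = 0 := h
    exact (map_eq_zero_iff e he).1 h'

theorem Padic.exists_mulShift_ne_one {χ : AddChar ℚ_[p] Circle} (hχ : ∃ x, χ x ≠ 1) {x : ℚ_[p]}
    (hx : x ≠ 0) : ∃ y, χ.mulShift y x ≠ 1 := by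
  obtain ⟨z, hz⟩ := hχ
  exact ⟨z / x, by rwa [AddChar.mulShift_apply, div_mul_cancel₀ _ hx]⟩

theorem Padic.continuous_mulShift {χ : AddChar ℚ_[p] Circle} (hχ : Continuous χ) (y : ℚ_[p]) :
    Continuous (χ.mulShift y) := by
  have : (χ.mulShift y : ℚ_[p] → Circle) = fun x => χ (y * x) := by
    ext x; rw [AddChar.mulShift_apply]
  rw [this]
  fun_prop

theorem Padic.map_eq_map_one_mul {α : ℚ_[p] →+ ℚ_[p]} (hα : Continuous α) (x : ℚ_[p]) :
    α x = α 1 * x := by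
  refine congrFun (Padic.denseRange_ratCast p |>.equalizer hα (by fun_prop) ?_) x
  ext q
  simpa [mul_comm, Rat.smul_def] using map_rat_smul α q (1 : ℚ_[p])

variable [MeasurableSpace ℚ_[p]]

/-- A distribution on `ℚ_[p]` is degenerate if its characteristic function has modulus one. -/
theorem Padic.isDegenerate_of_norm_characteristicFunction_eq_one {μ : Measure ℚ_[p]}
    [IsProbabilityMeasure μ] {χ : AddChar ℚ_[p] Circle} (hχ : Continuous χ) (hχ' : ∃ x, χ x ≠ 1)
    (h : ∀ y, ‖characteristicFunction μ (χ.mulShift y)‖ = 1) : IsDegenerate μ := by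
  choose c hc using fun y => exists_ae_eq_of_norm_characteristicFunction_eq_one (h y)
  -- The null set depends on y, so only countably many y are used; continuity in y recovers the
  -- rest.
  have hall : ∀ᵐ x ∂μ, ∀ n : ℕ,
      (χ.mulShift (TopologicalSpace.denseSeq ℚ_[p] n) x : ℂ) =
        c (TopologicalSpace.denseSeq ℚ_[p] n) :=
    ae_all_iff.2 fun n => hc _
  obtain ⟨x₀, hx₀⟩ := hall.exists
  have heq : ∀ᵐ x ∂μ, x = x₀ := by
    filter_upwards [hall] with x hx
    by_contra hne
    obtain ⟨y, hy⟩ := Padic.exists_mulShift_ne_one hχ' (sub_ne_zero.2 hne)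
    refine hy ?_
    have : (fun y => χ (y * (x - x₀))) = fun _ => 1 := by
      refine (TopologicalSpace.denseRange_denseSeq ℚ_[p]).equalizer (by fun_prop) (by fun_prop) ?_
      ext1 n
      have h1 := (hx n).trans (hx₀ n).symm
      rw [AddChar.mulShift_apply, AddChar.mulShift_apply] at h1
      simp only [Function.comp_apply, mul_sub]
      rw [AddChar.map_sub_eq_div, Circle.ext h1, div_self']
    exact congrFun this y
  refine ⟨x₀, ?_⟩
  have h' : μ.map id = μ.map fun _ => x₀ := Measure.map_congr heq
  simpa using h'

variable [BorelSpace ℚ_[p]]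

theorem Padic.continuous_characteristicFunction_mulShift (μ : Measure ℚ_[p]) [IsFiniteMeasure μ]
    {χ : AddChar ℚ_[p] Circle} (hχ : Continuous χ) :
    Continuous fun y => characteristicFunction μ (χ.mulShift y) := by
  refine continuous_of_dominated (bound := fun _ => 1) (fun y => ?_) (fun y => ?_)
    (integrable_const _) ?_
  · exact (integrable_addChar μ (Padic.continuous_mulShift hχ y)).aestronglyMeasurable
  · exact Eventually.of_forall fun _ => (Circle.norm_coe _).le
  · refine Eventually.of_forall fun x => ?_
    simp only [AddChar.mulShift_apply]
    fun_prop

/-- **Heyde's functional equation** for the characteristic functions. -/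
theorem Padic.heyde_equation {Ω : Type*} [MeasurableSpace Ω] {P : Measure Ω}
    [IsProbabilityMeasure P] {ξ₁ ξ₂ : Ω → ℚ_[p]} (h₁ : Measurable ξ₁) (h₂ : Measurable ξ₂)
    (hind : IndepFun ξ₁ ξ₂ P) {c : ℚ_[p]}
    (hsymm : CondDistribSymmetric (fun ω => ξ₁ ω + c * ξ₂ ω) (fun ω => ξ₁ ω + ξ₂ ω) P)
    {χ : AddChar ℚ_[p] Circle} (hχ : Continuous χ) (u v : ℚ_[p]) :
    characteristicFunction (P.map ξ₁) (χ.mulShift (u + v)) *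
        characteristicFunction (P.map ξ₂) (χ.mulShift (u + c * v)) =
      characteristicFunction (P.map ξ₁) (χ.mulShift (u - v)) *
        characteristicFunction (P.map ξ₂) (χ.mulShift (u - c * v)) := by
  have hmeas : ∀ y, Measurable fun x => (χ.mulShift y x : ℂ) := fun y =>
    (continuous_subtype_val.comp (Padic.continuous_mulShift hχ y)).measurable
  have hprod : ∀ a b, characteristicFunction (P.map ξ₁) (χ.mulShift a) *
      characteristicFunction (P.map ξ₂) (χ.mulShift b) = ∫ ω, (χ (a * ξ₁ ω + b * ξ₂ ω) : ℂ) ∂P := by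
    intro a b
    have := (hind.comp (hmeas a) (hmeas b)).integral_fun_mul_eq_mul_integral
      ((hmeas a).comp h₁).aestronglyMeasurable ((hmeas b).comp h₂).aestronglyMeasurable
    rw [characteristicFunction, characteristicFunction,
      integral_map h₁.aemeasurable (hmeas a).aestronglyMeasurable,
      integral_map h₂.aemeasurable (hmeas b).aestronglyMeasurable]
    simp only [Function.comp_def] at this
    rw [← this]
    simp [AddChar.map_add_eq_mul, AddChar.mulShift_apply]
  have hL₂ : Measurable fun ω => ξ₁ ω + c * ξ₂ ω := h₁.add (h₂.const_mul c)
  have hmap := (condDistribSymmetric_iff_map_eq hL₂).1 hsymm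
  have hF : Measurable fun z : ℚ_[p] × ℚ_[p] => (χ (u * z.1 + v * z.2) : ℂ) :=
    Continuous.measurable (by fun_prop)
  have hint := congrArg (fun ν => ∫ z, (χ (u * z.1 + v * z.2) : ℂ) ∂ν) hmap
  rw [integral_map (by fun_prop) hF.aestronglyMeasurable,
    integral_map (by fun_prop) hF.aestronglyMeasurable] at hint
  rw [hprod, hprod]
  convert hint using 3
  · exact congrArg (fun z => (χ z : ℂ)) (by ring)
  · exact congrArg (fun z => (χ z : ℂ)) (by ring)

theorem Padic.isDegenerate_of_heyde_equation {μ ν : Measure ℚ_[p]} [IsProbabilityMeasure μ]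
    [IsProbabilityMeasure ν] (hμ : NonvanishingCharFun μ) (hν : NonvanishingCharFun ν)
    {χ : AddChar ℚ_[p] Circle} (hχ : Continuous χ) (hχ' : ∃ x, χ x ≠ 1) {c : ℚ_[p]} (hc : c ≠ -1)
    (h : ∀ u v, characteristicFunction μ (χ.mulShift (u + v)) *
        characteristicFunction ν (χ.mulShift (u + c * v)) =
      characteristicFunction μ (χ.mulShift (u - v)) *
        characteristicFunction ν (χ.mulShift (u - c * v))) : IsDegenerate μ := by
  have hμ' := fun y => norm_ne_zero_iff.2 (hμ _ (Padic.continuous_mulShift hχ y))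
  have hν' := fun y => norm_ne_zero_iff.2 (hν _ (Padic.continuous_mulShift hχ y))
  refine Padic.isDegenerate_of_norm_characteristicFunction_eq_one hχ hχ' fun y => ?_
  have hlog := eq_zero_of_heyde_equation
    (φ₁ := fun y => Real.log ‖characteristicFunction μ (χ.mulShift y)‖)
    (φ₂ := fun y => Real.log ‖characteristicFunction ν (χ.mulShift y)‖) hc
    ((Padic.continuous_characteristicFunction_mulShift μ hχ).norm.log hμ')
    (by simp [AddChar.mulShift_zero, characteristicFunction_one])
    (by simp [AddChar.mulShift_zero, characteristicFunction_one])
    (fun x => by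
      have : χ.mulShift (-x) = (χ.mulShift x)⁻¹ := by
        ext z; simp [AddChar.mulShift_apply, AddChar.inv_apply]
      simp only [this, norm_characteristicFunction_inv])
    (fun x => Real.log_nonpos (norm_nonneg _) (norm_characteristicFunction_le_one _ _))
    (fun x => Real.log_nonpos (norm_nonneg _) (norm_characteristicFunction_le_one _ _))
    (fun u v => by
      rw [← Real.log_mul (hμ' _) (hν' _), ← Real.log_mul (hμ' _) (hν' _), ← norm_mul, h,
        norm_mul]) y
  exact Real.eq_one_of_pos_of_log_eq_zero (lt_of_le_of_ne (norm_nonneg _) (hμ' y).symm) hlog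

end Padic

/-! ### The converse for α = -I, and the main theorem -/

/-- An i.i.d. pair is exchangeable, and swapping it fixes the sum and negates the difference. -/
theorem condDistribSymmetric_sub_add {Ω X : Type*} [MeasurableSpace Ω] [AddCommGroup X]
    [MeasurableSpace X] [StandardBorelSpace X] [MeasurableAdd₂ X] [MeasurableNeg X]
    {P : Measure Ω} [IsFiniteMeasure P] {ξ₁ ξ₂ : Ω → X}
    (h₁ : Measurable ξ₁) (h₂ : Measurable ξ₂) (hind : IndepFun ξ₁ ξ₂ P)
    (hlaw : P.map ξ₁ = P.map ξ₂) :
    CondDistribSymmetric (fun ω => ξ₁ ω + -ξ₂ ω) (fun ω => ξ₁ ω + ξ₂ ω) P := by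
  refine (condDistribSymmetric_iff_map_eq (h₁.add h₂.neg)).2 ?_
  have hswap : P.map (fun ω => (ξ₁ ω, ξ₂ ω)) = P.map (fun ω => (ξ₂ ω, ξ₁ ω)) := by
    rw [(indepFun_iff_map_prod_eq_prod_map_map h₁.aemeasurable h₂.aemeasurable).1 hind,
      (indepFun_iff_map_prod_eq_prod_map_map h₂.aemeasurable h₁.aemeasurable).1 hind.symm, hlaw]
  have hg : Measurable fun z : X × X => (z.1 + z.2, z.1 + -z.2) := by fun_prop
  have := congrArg (Measure.map fun z : X × X => (z.1 + z.2, z.1 + -z.2)) hswap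
  rw [Measure.map_map hg (by fun_prop), Measure.map_map hg (by fun_prop)] at this
  exact this.trans (congrArg (P.map ·)
    (funext fun ω => Prod.ext (add_comm _ _) (by simp [add_comm])))

theorem proposition2p9 (p : ℕ) [Fact p.Prime] [MeasurableSpace ℚ_[p]] [BorelSpace ℚ_[p]]
    (α : ℚ_[p] ≃ₜ+ ℚ_[p]) :
    -- If `α ≠ -I`, both distributions are degenerate; if `α = -I`, they coincide.
    (∀ (Ω : Type*) [MeasurableSpace Ω] (P : Measure Ω) [IsProbabilityMeasure P]
        (ξ₁ ξ₂ : Ω → ℚ_[p]), Measurable ξ₁ → Measurable ξ₂ → IndepFun ξ₁ ξ₂ P →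
        NonvanishingCharFun (P.map ξ₁) → NonvanishingCharFun (P.map ξ₂) →
        CondDistribSymmetric (fun ω => ξ₁ ω + α (ξ₂ ω)) (fun ω => ξ₁ ω + ξ₂ ω) P →
          ((α : ℚ_[p] → ℚ_[p]) ≠ (fun x => -x) →
            IsDegenerate (P.map ξ₁) ∧ IsDegenerate (P.map ξ₂)) ∧
          ((α : ℚ_[p] → ℚ_[p]) = (fun x => -x) → P.map ξ₁ = P.map ξ₂)) ∧
    -- If `α = -I`, the common distribution `ω` can be arbitrary: independent random variables
    -- with distribution `ω` exist, and any such pair satisfies the symmetry condition.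
    ((α : ℚ_[p] → ℚ_[p]) = (fun x => -x) →
      ∀ (μ : Measure ℚ_[p]) [IsProbabilityMeasure μ],
        (∃ (Ω : Type) (_ : MeasurableSpace Ω) (P : Measure Ω) (_ : IsProbabilityMeasure P)
          (ξ₁ ξ₂ : Ω → ℚ_[p]), Measurable ξ₁ ∧ Measurable ξ₂ ∧ IndepFun ξ₁ ξ₂ P ∧
          P.map ξ₁ = μ ∧ P.map ξ₂ = μ) ∧
        ∀ (Ω : Type*) [MeasurableSpace Ω] (P : Measure Ω) [IsProbabilityMeasure P]
          (ξ₁ ξ₂ : Ω → ℚ_[p]), Measurable ξ₁ → Measurable ξ₂ → IndepFun ξ₁ ξ₂ P →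
          P.map ξ₁ = μ → P.map ξ₂ = μ →
          CondDistribSymmetric (fun ω => ξ₁ ω + α (ξ₂ ω)) (fun ω => ξ₁ ω + ξ₂ ω) P) := by
  obtain ⟨χ, hχ, hχ'⟩ := Padic.exists_continuous_addChar_ne_one (p := p)
  have hα : ∀ x, α x = α 1 * x := fun x =>
    Padic.map_eq_map_one_mul (α := (α : ℚ_[p] →+ ℚ_[p])) α.continuous x
  have hα0 : α 1 ≠ 0 := fun h => one_ne_zero (α.injective (h.trans (map_zero α).symm))
  refine ⟨?_, ?_⟩
  · intro Ω _ P _ ξ₁ ξ₂ h₁ h₂ hind hf₁ hf₂ hsymm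
    have := Measure.isProbabilityMeasure_map (μ := P) h₁.aemeasurable
    have := Measure.isProbabilityMeasure_map (μ := P) h₂.aemeasurable
    have hL₂ : (fun ω => ξ₁ ω + α (ξ₂ ω)) = fun ω => ξ₁ ω + α 1 * ξ₂ ω :=
      funext fun ω => by rw [hα]
    rw [hL₂] at hsymm
    have heq := fun (ψ : AddChar ℚ_[p] Circle) (hψ : Continuous ψ) =>
      Padic.heyde_equation h₁ h₂ hind hsymm hψ
    refine ⟨fun hne => ?_, fun hneg => ?_⟩
    · have hc : α 1 ≠ -1 := fun h => hne (funext fun x => by rw [hα, h, neg_one_mul])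
      refine ⟨Padic.isDegenerate_of_heyde_equation hf₁ hf₂ hχ hχ' hc (heq χ hχ),
        Padic.isDegenerate_of_heyde_equation hf₂ hf₁ hχ hχ' (c := (α 1)⁻¹) (fun h => hc ?_)
          fun u v => ?_⟩
      · rw [← inv_inv (α 1), h, inv_neg_one]
      -- Rescaling v exchanges the roles of the two distributions and replaces c by c⁻¹.
      · have := heq χ hχ u ((α 1)⁻¹ * v)
        rw [mul_inv_cancel_left₀ hα0] at this
        rw [mul_comm, this, mul_comm]
    · have hc : α 1 = -1 := congrFun hneg 1
      refine Measure.ext_of_characteristicFunction (fun x hx => ?_) fun y hy => ?_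
      · obtain ⟨z, hz⟩ := Padic.exists_mulShift_ne_one hχ' hx
        exact ⟨_, Padic.continuous_mulShift hχ z, hz⟩
      -- With c = -1 one factor on each side is evaluated at the trivial character and the other at
      -- y.
      · have := heq y hy (1 / 2) (1 / 2)
        rw [hc, neg_one_mul, sub_neg_eq_add, ← sub_eq_add_neg, add_halves, sub_self,
          AddChar.mulShift_zero, AddChar.mulShift_one, characteristicFunction_one,
          characteristicFunction_one, mul_one, one_mul] at this
        exact this
  · intro hneg μ _
    refine ⟨⟨ℚ_[p] × ℚ_[p], inferInstance, μ.prod μ, inferInstance, Prod.fst, Prod.snd,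
      measurable_fst, measurable_snd, indepFun_prod measurable_id measurable_id, ?_, ?_⟩, ?_⟩
    · rw [Measure.map_fst_prod, measure_univ, one_smul]
    · rw [Measure.map_snd_prod, measure_univ, one_smul]
    · intro Ω _ P _ ξ₁ ξ₂ h₁ h₂ hind hμ₁ hμ₂
      have hα' : ∀ x, α x = -x := congrFun hneg
      simp only [hα']
      exact condDistribSymmetric_sub_add h₁ h₂ hind (hμ₁.trans hμ₂.symm)
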